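/- Let $G$ be a finite simple graph with vertex set $V$, and let $\mathcal{S}(G)$ be the set of real symmetric matrices $A$ indexed by $V$ such that, for all $i\neq j$, $A_{ij}\neq 0$ if and only if $\{i,j\}$ is an edge of $G$ (the diagonal entries are arbitrary). For a set $\beta$ of edges of the complement $\overline{G}$, let $G+\beta$ be the graph obtained from $G$ by adding the edges in $\beta$. A real symmetric matrix $A$ has the SSP (respectively, the SAP) if $X=O$ is the only real symmetric matrix with $A\circ X=I\circ X=O$ (entrywise products) and $AX-XA=O$ (respectively, $AX=O$). If $H$ is a graph on $V$ that contains all edges of $G$, a matrix $A\in\mathcal{S}(G)$ has the SSP (respectively, the SAP) with respect to $H$ if $X=O$ is the only real symmetric matrix with zero diagonal such that $X_{ij}=0$ for every edge $\{i,j\}$ of $H$ and $AX-XA=O$ (respectively, $AX=O$). A nonempty set $\beta\subseteq E(\overline{G})$ is an SSP (respectively, SAP) liberation set of a matrix $A\in\mathcal{S}(G)$ if $A$ has the SSP (respectively, the SAP) with respect to $G+\beta'$ for every $\beta'\subset\beta$ with $|\beta'|=|\beta|-1$. It is an SSP (respectively, SAP) liberation set of $G$ if it is an SSP (respectively, SAP)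 liberation set of every $A\in\mathcal{S}(G)$. Theorem. 1. If $\beta$ is an SSP liberation set of $G$, then for every $A\in\mathcal{S}(G)$ there is a matrix $A'\in\mathcal{S}(G+\beta)$ that has the SSP and satisfies $\operatorname{spec}(A')=\operatorname{spec}(A)$, where $\operatorname{spec}$ denotes the multiset of eigenvalues, counted with multiplicity. 2. If $\beta$ is an SAP liberation set of $G$, then for every $A\in\mathcal{S}(G)$ there is a matrix $A'\in\mathcal{S}(G+\beta)$ that has the SAP and satisfies $\operatorname{rank}(A')=\operatorname{rank}(A)$. -/

import Mathlib

namespace InverseEigenvalue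

/-- `𝒮(G)`: the real symmetric matrices, indexed by the vertices of `G`, whose off-diagonal
`(i,j)`-entry is nonzero if and only if `{i,j}` is an edge of `G`; the diagonal is free. -/
def graphMatrices {V : Type*} (G : SimpleGraph V) : Set (Matrix V V ℝ) :=
  {A | A.IsSymm ∧ ∀ i j, i ≠ j → (A i j ≠ 0 ↔ G.Adj i j)}

/-- `𝒮₀ᶜˡ(G)`: the real symmetric matrices with zero diagonal whose off-diagonal
`(i,j)`-entry is nonzero only when `{i,j}` is an edge of `G`. -/
def closedGraphMatricesZeroDiag {V : Type*} (G : SimpleGraph V) : Set (Matrix V V ℝ) :=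
  {X | X.IsSymm ∧ (∀ i, X i i = 0) ∧ ∀ i j, i ≠ j → X i j ≠ 0 → G.Adj i j}

/-- The spectrum of a real symmetric matrix, as a multiset: every eigenvalue is listed with
its multiplicity. -/
noncomputable def spec {V : Type*} [Fintype V] [DecidableEq V] (A : Matrix V V ℝ) :
    Multiset ℝ :=
  A.charpoly.roots

/-- The strong spectral property: `X = 0` is the only symmetric matrix with
`A ∘ X = I ∘ X = 0` (entrywise products) and `[A, X] = AX - XA = 0`. -/
def HasSSP {V : Type*} [Fintype V] [DecidableEq V] (A : Matrix V V ℝ) : Prop :=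
  ∀ X : Matrix V V ℝ, X.IsSymm → A.hadamard X = 0 → (1 : Matrix V V ℝ).hadamard X = 0 →
    A * X - X * A = 0 → X = 0

/-- The strong Arnold property: `X = 0` is the only symmetric matrix with
`A ∘ X = I ∘ X = 0` (entrywise products) and `AX = 0`. -/
def HasSAP {V : Type*} [Fintype V] [DecidableEq V] (A : Matrix V V ℝ) : Prop :=
  ∀ X : Matrix V V ℝ, X.IsSymm → A.hadamard X = 0 → (1 : Matrix V V ℝ).hadamard X = 0 →
    A * X = 0 → X = 0

/-- The strong spectral property of `A` with respect to a graph `H`. -/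
def HasSSPWrt {V : Type*} [Fintype V] (A : Matrix V V ℝ) (H : SimpleGraph V) : Prop :=
  ∀ X ∈ closedGraphMatricesZeroDiag Hᶜ, A * X - X * A = 0 → X = 0

/-- The strong Arnold property of `A` with respect to a graph `H`. -/
def HasSAPWrt {V : Type*} [Fintype V] (A : Matrix V V ℝ) (H : SimpleGraph V) : Prop :=
  ∀ X ∈ closedGraphMatricesZeroDiag Hᶜ, A * X = 0 → X = 0

/-- The spanning supergraph `G + β`: the graph `G` with the edges in `β` added. -/
def addEdges {V : Type*} (G : SimpleGraph V) (β : Finset (Sym2 V)) : SimpleGraph V :=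
  G ⊔ SimpleGraph.fromEdgeSet (β : Set (Sym2 V))

/-- `β` is an SSP liberation set of the matrix `A ∈ 𝒮(G)`: a nonempty set of nonedges of `G`
such that `A` has the SSP with respect to `G + β'` for all `β' ⊂ β` with `|β'| = |β| - 1`. -/
def IsSSPLiberationSetOfMatrix {V : Type*} [Fintype V] (G : SimpleGraph V)
    (A : Matrix V V ℝ) (β : Finset (Sym2 V)) : Prop :=
  β.Nonempty ∧ (β : Set (Sym2 V)) ⊆ Gᶜ.edgeSet ∧
    ∀ β' : Finset (Sym2 V), β' ⊂ β → β'.card = β.card - 1 → HasSSPWrt A (addEdges G β')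

/-- `β` is an SAP liberation set of the matrix `A ∈ 𝒮(G)`: a nonempty set of nonedges of `G`
such that `A` has the SAP with respect to `G + β'` for all `β' ⊂ β` with `|β'| = |β| - 1`. -/
def IsSAPLiberationSetOfMatrix {V : Type*} [Fintype V] (G : SimpleGraph V)
    (A : Matrix V V ℝ) (β : Finset (Sym2 V)) : Prop :=
  β.Nonempty ∧ (β : Set (Sym2 V)) ⊆ Gᶜ.edgeSet ∧
    ∀ β' : Finset (Sym2 V), β' ⊂ β → β'.card = β.card - 1 → HasSAPWrt A (addEdges G β')

/-- `β` is an SSP liberation set of the graph `G`: one of every matrix in `𝒮(G)`. -/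
def IsSSPLiberationSet {V : Type*} [Fintype V] (G : SimpleGraph V) (β : Finset (Sym2 V)) :
    Prop :=
  ∀ A ∈ graphMatrices G, IsSSPLiberationSetOfMatrix G A β

/-- `β` is an SAP liberation set of the graph `G`: one of every matrix in `𝒮(G)`. -/
def IsSAPLiberationSet {V : Type*} [Fintype V] (G : SimpleGraph V) (β : Finset (Sym2 V)) :
    Prop :=
  ∀ A ∈ graphMatrices G, IsSAPLiberationSetOfMatrix G A β

end InverseEigenvalue

open scoped Matrix Matrix.Norms.Operator Topology
open Filter

namespace InverseEigenvalue

/-! Perturb `A` inside a smooth family that preserves the invariant: orthogonal conjugates `exp(-S)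
A exp(S)` with `S` skew for the spectrum, congruences `(1 + K)ᵀ A (1 + K)` with `K` small for the
rank. By trace duality, the strong property with respect to `G + (β - e)` says that the tangent
space of the family at `A` realises every symmetric pattern on the nonedges of that graph
(`range_rangeRestrict_nonedgePart_comp`). So for each `e ∈ β` some tangent vector is nonzero at `e`
and zero on all nonedges of `G + β`. A real vector space is not a finite union of proper subspaces,
so one tangent vector serves all `e` at once.

The implicit function theorem integrates it to a curve whose entries at the nonedges of `G + β` stay
zero, while those at `β` leave zero at first order and those at edges of `G` stay nonzero
(`frequently_mem_graphMatrices_addEdges`). The strong property with respect to `G + β` is an open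
condition, so it survives near `A`. -/

open Classical in
/-- The symmetrised projection onto the entries at the nonedges of `H`. -/
noncomputable def nonedgePart {V : Type*} (H : SimpleGraph V) :
    Matrix V V ℝ →ₗ[ℝ] Matrix V V ℝ where
  toFun M := Matrix.of fun i j => if Hᶜ.Adj i j then M i j + M j i else 0
  map_add' M N := by
    ext i j
    by_cases h : Hᶜ.Adj i j
    · simp only [Matrix.of_apply, Matrix.add_apply, if_pos h]; ring
    · simp only [Matrix.of_apply, Matrix.add_apply, if_neg h]; ring
  map_smul' c M := by
    ext i j
    by_cases h : Hᶜ.Adj i j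
    · simp only [Matrix.of_apply, Matrix.smul_apply, if_pos h, smul_eq_mul, RingHom.id_apply]; ring
    · simp only [Matrix.of_apply, Matrix.smul_apply, if_neg h, smul_eq_mul, RingHom.id_apply,
        mul_zero]

theorem nonedgePart_apply_of_adj {V : Type*} {H : SimpleGraph V} {i j : V} (h : Hᶜ.Adj i j)
    (M : Matrix V V ℝ) : nonedgePart H M i j = M i j + M j i := by
  simp [nonedgePart, if_pos h]

theorem nonedgePart_apply_of_not_adj {V : Type*} {H : SimpleGraph V} {i j : V}
    (h : ¬ Hᶜ.Adj i j) (M : Matrix V V ℝ) : nonedgePart H M i j = 0 := by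
  simp [nonedgePart, if_neg h]

theorem nonedgePart_eq_zero_iff {V : Type*} {H : SimpleGraph V} {M : Matrix V V ℝ}
    (hM : M.IsSymm) : nonedgePart H M = 0 ↔ ∀ i j, Hᶜ.Adj i j → M i j = 0 := by
  constructor
  · intro h i j hij
    have h1 := congrFun (congrFun h i) j
    rw [nonedgePart_apply_of_adj hij, hM.apply i j] at h1
    simp only [Matrix.zero_apply] at h1
    linarith
  · intro h
    ext i j
    by_cases hij : Hᶜ.Adj i j
    · rw [nonedgePart_apply_of_adj hij, h i j hij, h j i hij.symm, Matrix.zero_apply, add_zero]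
    · rw [nonedgePart_apply_of_not_adj hij, Matrix.zero_apply]

theorem nonedgePart_single_comm {V : Type*} [DecidableEq V] (H : SimpleGraph V) (i j : V) :
    nonedgePart H (Matrix.single i j 1) = nonedgePart H (Matrix.single j i 1) := by
  ext a b
  by_cases h : Hᶜ.Adj a b
  · rw [nonedgePart_apply_of_adj h, nonedgePart_apply_of_adj h]
    simp only [Matrix.single_apply, and_comm, add_comm]
  · rw [nonedgePart_apply_of_not_adj h, nonedgePart_apply_of_not_adj h]

theorem nonedgePart_single_of_not_adj {V : Type*} [DecidableEq V] {H : SimpleGraph V} {i j : V}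
    (hij : ¬ Hᶜ.Adj i j) : nonedgePart H (Matrix.single i j 1) = 0 := by
  ext a b
  by_cases h : Hᶜ.Adj a b
  · rw [nonedgePart_apply_of_adj h, Matrix.single_apply_of_ne, Matrix.single_apply_of_ne]
    · simp
    · rintro ⟨rfl, rfl⟩; exact hij h.symm
    · rintro ⟨rfl, rfl⟩; exact hij h
  · rw [nonedgePart_apply_of_not_adj h, Matrix.zero_apply]

theorem closedGraphMatricesZeroDiag_mono {V : Type*} {G H : SimpleGraph V} (h : G ≤ H) :
    closedGraphMatricesZeroDiag G ⊆ closedGraphMatricesZeroDiag H :=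
  fun _ hX => ⟨hX.1, hX.2.1, fun i j hij h0 => h (hX.2.2 i j hij h0)⟩

theorem addEdges_mono {V : Type*} (G : SimpleGraph V) {β γ : Finset (Sym2 V)} (h : β ⊆ γ) :
    addEdges G β ≤ addEdges G γ :=
  sup_le_sup_left (SimpleGraph.fromEdgeSet_mono (by exact_mod_cast h)) G

theorem mem_closedGraphMatricesZeroDiag_compl {V : Type*} [DecidableEq V] {H : SimpleGraph V}
    {A X : Matrix V V ℝ}
    (hA : A ∈ graphMatrices H) (hX : X.IsSymm) (hAX : A.hadamard X = 0)
    (hdiag : (1 : Matrix V V ℝ).hadamard X = 0) : X ∈ closedGraphMatricesZeroDiag Hᶜ := by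
  refine ⟨hX, fun i => ?_, fun i j hij h => ?_⟩
  · simpa using congrFun (congrFun hdiag i) i
  · refine (SimpleGraph.compl_adj _ _ _).2 ⟨hij, fun hadj => ?_⟩
    have h1 : A i j * X i j = 0 := congrFun (congrFun hAX i) j
    exact mul_ne_zero ((hA.2 i j hij).2 hadj) h h1

theorem eq_zero_of_trace_mul_transpose_self {V : Type*} [Fintype V] {C : Matrix V V ℝ}
    (h : (C * Cᵀ).trace = 0) : C = 0 := by
  rw [← Matrix.conjTranspose_eq_transpose_of_trivial] at h
  exact Matrix.trace_mul_conjTranspose_self_eq_zero_iff.1 h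

/-- Transposition as a continuous linear map. -/
noncomputable def transposeCLM (V : Type*) [Fintype V] : Matrix V V ℝ →L[ℝ] Matrix V V ℝ :=
  (Matrix.transposeLinearEquiv V V ℝ ℝ).toLinearMap.toContinuousLinearMap

/-- `K ↦ K - Kᵀ`, a parametrisation of the skew-symmetric matrices. -/
noncomputable def skewPart {V : Type*} [Fintype V] : Matrix V V ℝ →L[ℝ] Matrix V V ℝ :=
  ContinuousLinearMap.id ℝ _ - transposeCLM V

theorem skewPart_apply {V : Type*} [Fintype V] (K : Matrix V V ℝ) : skewPart K = K - Kᵀ := rfl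

variable {V : Type*} [Fintype V] [DecidableEq V]

/-! ### Transversality and perturbation along a smooth family -/

/-- If only the zero matrix supported on the nonedges of `H` is orthogonal to the range of `L`,
then the range of `L` covers all symmetric patterns on the nonedges of `H`. -/
theorem range_rangeRestrict_nonedgePart_comp {E : Type*} [AddCommGroup E] [Module ℝ E]
    (H : SimpleGraph V) (L : E →ₗ[ℝ] Matrix V V ℝ)
    (hL : ∀ X ∈ closedGraphMatricesZeroDiag Hᶜ, (∀ k, (X * L k).trace = 0) → X = 0) :
    LinearMap.range ((nonedgePart H).rangeRestrict ∘ₗ L) = ⊤ := by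
  by_contra hne
  obtain ⟨φ, hφ, hker⟩ := Submodule.exists_le_ker_of_lt_top _ (lt_top_iff_ne_top.2 hne)
  set P := (nonedgePart H).rangeRestrict
  have hP : ∀ M N, nonedgePart H M = nonedgePart H N → P M = P N := fun M N h => Subtype.ext h
  -- `X` represents the functional `φ ∘ P` in the trace pairing; it annihilates the range of `L`.
  let X : Matrix V V ℝ := Matrix.of fun i j => φ (P (Matrix.single i j 1))
  have hsymm : X.IsSymm := by
    ext i j
    exact congrArg φ (hP _ _ (nonedgePart_single_comm H j i))
  have hX : ∀ i j, ¬ Hᶜ.Adj i j → X i j = 0 := by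
    intro i j hij
    have : P (Matrix.single i j 1) = 0 := Subtype.ext (nonedgePart_single_of_not_adj hij)
    simp only [X, Matrix.of_apply, this, map_zero]
  have htr : ∀ M, φ (P M) = (X * M).trace := by
    intro M
    conv_lhs => rw [Matrix.matrix_eq_sum_single M]
    simp only [map_sum]
    rw [Finset.sum_comm]
    simp only [Matrix.trace, Matrix.diag_apply, Matrix.mul_apply]
    refine Finset.sum_congr rfl fun i _ => Finset.sum_congr rfl fun j _ => ?_
    have : Matrix.single j i (M j i) = M j i • Matrix.single j i (1 : ℝ) := by
      rw [Matrix.smul_single, smul_eq_mul, mul_one]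
    rw [this, map_smul, map_smul, smul_eq_mul, mul_comm, ← hsymm.apply i j]
    rfl
  have hX0 : X = 0 := by
    refine hL X ⟨hsymm, fun i => hX i i (Hᶜ.irrefl), fun i j _ h => ?_⟩ fun k => ?_
    · by_contra hij
      exact h (hX i j hij)
    · rw [← htr]
      exact hker ⟨k, rfl⟩
  apply hφ
  ext y
  obtain ⟨M, rfl⟩ := (nonedgePart H).surjective_rangeRestrict y
  rw [htr M, hX0]
  simp

/-- Moving a matrix of `𝒮(G)` along a smooth family of symmetric matrices: if the tangent space of
the family is transversal to the pattern of `G + (β - e)` for every `e ∈ β`, then the family meets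
`𝒮(G + β)` arbitrarily close to the base point. -/
theorem frequently_mem_graphMatrices_addEdges {E : Type*} [NormedAddCommGroup E]
    [NormedSpace ℝ E] [CompleteSpace E] {G : SimpleGraph V} {β : Finset (Sym2 V)}
    (hne : β.Nonempty) (hβ : (β : Set (Sym2 V)) ⊆ Gᶜ.edgeSet) {Φ : E → Matrix V V ℝ}
    {L : E →L[ℝ] Matrix V V ℝ} (hΦ : HasStrictFDerivAt Φ L 0) (hsymm : ∀ x, (Φ x).IsSymm)
    (h0 : Φ 0 ∈ graphMatrices G)
    (hL : ∀ e ∈ β, ∀ X ∈ closedGraphMatricesZeroDiag (addEdges G (β.erase e))ᶜ,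
      (∀ k, (X * L k).trace = 0) → X = 0) :
    ∃ᶠ x in 𝓝 0, Φ x ∈ graphMatrices (addEdges G β) := by
  set H := addEdges G β with hH
  have hLsymm : ∀ k, (L k).IsSymm := by
    have h1 : HasStrictFDerivAt (fun x => (Φ x)ᵀ) ((transposeCLM V).comp L) 0 :=
      (transposeCLM V).hasStrictFDerivAt.comp 0 hΦ
    have h2 : (fun x => (Φ x)ᵀ) = Φ := funext hsymm
    rw [h2] at h1
    intro k
    exact DFunLike.congr_fun (h1.hasFDerivAt.unique hΦ.hasFDerivAt) k
  have hadj : ∀ {γ : Finset (Sym2 V)} {i j : V},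
      (addEdges G γ).Adj i j ↔ G.Adj i j ∨ (s(i, j) ∈ γ ∧ i ≠ j) := by
    intro γ i j
    simp [addEdges]
  have hmono : ∀ e, ∀ X ∈ closedGraphMatricesZeroDiag Hᶜ,
      X ∈ closedGraphMatricesZeroDiag (addEdges G (β.erase e))ᶜ := by
    rintro e X ⟨hX1, hX2, hX3⟩
    refine ⟨hX1, hX2, fun i j hij h => ?_⟩
    have h1 := hX3 i j hij h
    rw [SimpleGraph.compl_adj] at h1 ⊢
    refine ⟨hij, fun h2 => h1.2 ?_⟩
    rw [hadj] at h2
    rw [hH, hadj]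
    exact h2.imp_right fun h3 => ⟨Finset.mem_of_mem_erase h3.1, hij⟩
  obtain ⟨e₀, he₀⟩ := hne
  -- a direction in which all entries at `β` move
  have hdir : ∀ e : β, ∃ k ∈ LinearMap.ker (nonedgePart H ∘ₗ (L : E →ₗ[ℝ] Matrix V V ℝ)),
      (Matrix.entryLinearMap ℝ ℝ e.1.out.1 e.1.out.2 ∘ₗ (L : E →ₗ[ℝ] Matrix V V ℝ)) k ≠ 0 := by
    rintro ⟨e, he⟩
    have hsurj := range_rangeRestrict_nonedgePart_comp _ (L : E →ₗ[ℝ] Matrix V V ℝ) (hL e he)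
    have heq : s(e.out.1, e.out.2) = e := Quot.out_eq e
    generalize e.out.1 = a at heq
    generalize e.out.2 = b at heq
    -- `e = {a, b}` is still a nonedge of `G + (β - e)`, so the pattern supported on `e` alone is
    -- attained.
    obtain ⟨k, hk⟩ := LinearMap.range_eq_top.1 hsurj
      ((nonedgePart (addEdges G (β.erase e))).rangeRestrict (Matrix.single a b 1))
    replace hk : nonedgePart (addEdges G (β.erase e)) (L k) =
      nonedgePart (addEdges G (β.erase e)) (Matrix.single a b 1) := congrArg Subtype.val hk
    have hab : Gᶜ.Adj a b := by
      rw [← SimpleGraph.mem_edgeSet, heq]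
      exact hβ he
    rw [SimpleGraph.compl_adj] at hab
    refine ⟨k, ?_, ?_⟩
    · rw [LinearMap.mem_ker, LinearMap.comp_apply]
      refine (nonedgePart_eq_zero_iff (hLsymm k)).2 fun i j hij => ?_
      rw [SimpleGraph.compl_adj, hH, hadj] at hij
      have hij' : (addEdges G (β.erase e))ᶜ.Adj i j := by
        rw [SimpleGraph.compl_adj, hadj]
        refine ⟨hij.1, fun h => hij.2 (h.imp_right fun h3 => ⟨Finset.mem_of_mem_erase h3.1, hij.1⟩)⟩
      have hne' : s(i, j) ≠ s(a, b) := by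
        intro h
        exact hij.2 (Or.inr ⟨by rw [h, heq]; exact he, hij.1⟩)
      have h1 := congrFun (congrFun hk i) j
      rw [nonedgePart_apply_of_adj hij', nonedgePart_apply_of_adj hij', (hLsymm k).apply i j,
        Matrix.single_apply_of_ne, Matrix.single_apply_of_ne] at h1
      · linarith
      · rintro ⟨rfl, rfl⟩; exact hne' Sym2.eq_swap
      · rintro ⟨rfl, rfl⟩; exact hne' rfl
    · have hab' : (addEdges G (β.erase e))ᶜ.Adj a b := by
        rw [SimpleGraph.compl_adj, hadj]
        refine ⟨hab.1, fun h => h.elim hab.2 fun h => ?_⟩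
        rw [heq] at h
        exact Finset.notMem_erase _ _ h.1
      have h1 := congrFun (congrFun hk a) b
      rw [nonedgePart_apply_of_adj hab', nonedgePart_apply_of_adj hab', (hLsymm k).apply a b,
        Matrix.single_apply_same, Matrix.single_apply_of_ne] at h1
      · change L k a b ≠ 0
        intro h
        rw [h] at h1
        norm_num at h1
      · rintro ⟨h, -⟩; exact hab.1 h
  obtain ⟨k, hk, hkβ⟩ := Module.Dual.exists_forall_mem_ne_zero_of_forall_exists _ _ hdir
  have hkβ' : ∀ i j, s(i, j) ∈ β → L k i j ≠ 0 := by
    intro i j hij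
    have h1 : L k (s(i, j).out.1) (s(i, j).out.2) ≠ 0 := hkβ ⟨_, hij⟩
    have heq : s((s(i, j)).out.1, (s(i, j)).out.2) = s(i, j) := Quot.out_eq _
    rcases Sym2.eq_iff.1 heq with ⟨h2, h3⟩ | ⟨h2, h3⟩
    · rwa [h2, h3] at h1
    · rw [h2, h3] at h1
      rwa [(hLsymm k).apply i j] at h1
  -- a curve in the fibre with tangent vector `k`
  let P := (nonedgePart H).rangeRestrict.toContinuousLinearMap
  have hf : HasStrictFDerivAt (fun x => P (Φ x)) (P.comp L) 0 := P.hasStrictFDerivAt.comp 0 hΦ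
  have hf' : (P.comp L).range = ⊤ :=
    range_rangeRestrict_nonedgePart_comp H (L : E →ₗ[ℝ] Matrix V V ℝ)
      fun X hX => hL e₀ he₀ X (hmono e₀ X hX)
  have hk' : k ∈ (P.comp L).ker := Subtype.ext hk
  let g : ℝ → E := fun t => hf.implicitFunction _ _ hf' (P (Φ 0)) (t • ⟨k, hk'⟩)
  have hg0 : g 0 = 0 := by
    simp only [g, zero_smul]
    exact hf.implicitFunction_apply_image hf'
  have hline : HasDerivAt (fun t : ℝ => t • (⟨k, hk'⟩ : (P.comp L).ker)) ⟨k, hk'⟩ 0 := by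
    have h1 := (hasDerivAt_id (0 : ℝ)).smul_const (⟨k, hk'⟩ : (P.comp L).ker)
    rwa [one_smul] at h1
  have hg : HasDerivAt g k 0 := by
    have h1 := (hf.to_implicitFunction hf').hasFDerivAt
    have h2 : HasFDerivAt (hf.implicitFunction _ _ hf' (P (Φ 0))) (P.comp L).ker.subtypeL
      ((0 : ℝ) • (⟨k, hk'⟩ : (P.comp L).ker)) := by rwa [zero_smul]
    exact h2.comp_hasDerivAt 0 hline
  have hΦg : HasDerivAt (fun t => Φ (g t)) (L k) 0 := by
    have h2 : HasFDerivAt Φ L (g 0) := by rw [hg0]; exact hΦ.hasFDerivAt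
    exact h2.comp_hasDerivAt 0 hg
  have hentry : ∀ i j, HasDerivAt (fun t => Φ (g t) i j) (L k i j) 0 := fun i j =>
    (Matrix.entryLinearMap ℝ ℝ i j).toContinuousLinearMap.hasFDerivAt.comp_hasDerivAt 0 hΦg
  have hfib : ∀ᶠ t in 𝓝 (0 : ℝ), P (Φ (g t)) = P (Φ 0) := by
    have h1 := hf.map_implicitFunction_eq hf'
    have h2 : Tendsto (fun t : ℝ => (P (Φ 0), t • (⟨k, hk'⟩ : (P.comp L).ker))) (𝓝 0)
        (𝓝 (P (Φ 0), 0)) := by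
      refine tendsto_const_nhds.prodMk_nhds ?_
      have h3 := hline.continuousAt.tendsto
      rwa [zero_smul] at h3
    exact h2.eventually h1
  have hP0 : nonedgePart H (Φ 0) = 0 := by
    refine (nonedgePart_eq_zero_iff (hsymm 0)).2 fun i j hij => ?_
    rw [SimpleGraph.compl_adj, hH, hadj] at hij
    by_contra h
    exact hij.2 (Or.inl ((h0.2 i j hij.1).1 h))
  -- The neighbourhood is punctured because the entries at `β` vanish at `t = 0`; their nonzero
  -- derivatives make them nonzero nearby.
  have hev : ∀ᶠ t in 𝓝[≠] (0 : ℝ), Φ (g t) ∈ graphMatrices H := by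
    have hedges : ∀ᶠ t in 𝓝[≠] (0 : ℝ), ∀ i j, H.Adj i j → Φ (g t) i j ≠ 0 := by
      refine eventually_all.2 fun i => eventually_all.2 fun j => ?_
      by_cases hij : H.Adj i j
      · suffices ∀ᶠ t in 𝓝[≠] (0 : ℝ), Φ (g t) i j ≠ 0 from this.mono fun t ht _ => ht
        rw [hH, hadj] at hij
        rcases hij with hij | hij
        · refine ((hentry i j).continuousAt.eventually_ne ?_).filter_mono nhdsWithin_le_nhds
          rw [hg0]
          exact (h0.2 i j hij.ne).2 hij
        · exact (hentry i j).eventually_ne (hkβ' i j hij.1)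
      · exact Eventually.of_forall fun t h => absurd h hij
    filter_upwards [hedges, hfib.filter_mono nhdsWithin_le_nhds] with t ht1 ht2
    refine ⟨hsymm _, fun i j hij => ⟨fun h => ?_, ht1 i j⟩⟩
    by_contra hnadj
    have h1 : nonedgePart H (Φ (g t)) = 0 := (congrArg Subtype.val ht2).trans hP0
    exact h ((nonedgePart_eq_zero_iff (hsymm _)).1 h1 i j
      ((SimpleGraph.compl_adj _ _ _).2 ⟨hij, hnadj⟩))
  have htend : Tendsto g (𝓝[≠] 0) (𝓝 0) := by
    have := hg.continuousAt.tendsto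
    rw [hg0] at this
    exact this.mono_left nhdsWithin_le_nhds
  exact htend.frequently hev.frequently

/-! ### Openness of the strong properties -/

/-- The symmetric matrices with zero diagonal supported on `G`, as a submodule. -/
def closedGraphMatricesZeroDiagSubmodule (G : SimpleGraph V) : Submodule ℝ (Matrix V V ℝ) where
  carrier := closedGraphMatricesZeroDiag G
  zero_mem' := ⟨Matrix.isSymm_zero, fun _ => rfl, fun _ _ _ h => absurd rfl h⟩
  add_mem' := by
    rintro X Y ⟨hX1, hX2, hX3⟩ ⟨hY1, hY2, hY3⟩
    refine ⟨hX1.add hY1, fun i => by simp [hX2, hY2], fun i j hij h => ?_⟩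
    by_contra hG
    have h1 : X i j = 0 := by by_contra h; exact hG (hX3 i j hij h)
    have h2 : Y i j = 0 := by by_contra h; exact hG (hY3 i j hij h)
    simp [h1, h2] at h
  smul_mem' := by
    rintro c X ⟨hX1, hX2, hX3⟩
    refine ⟨hX1.smul c, fun i => by simp [hX2], fun i j hij h => hX3 i j hij fun h0 => ?_⟩
    simp [h0] at h

/-- The condition is injectivity of `D A` restricted to `Z`, and injective maps out of a
finite-dimensional space form an open set. -/
theorem isOpen_setOf_forall_mem_eq_zero {E F F' : Type*} [NormedAddCommGroup E] [NormedSpace ℝ E]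
    [NormedAddCommGroup F] [NormedSpace ℝ F] [FiniteDimensional ℝ F] [NormedAddCommGroup F']
    [NormedSpace ℝ F'] (D : E →L[ℝ] F →L[ℝ] F') (Z : Submodule ℝ F) :
    IsOpen {A : E | ∀ X ∈ Z, D A X = 0 → X = 0} := by
  have h1 : Continuous fun A => (D A).comp Z.subtypeL := by fun_prop
  convert (ContinuousLinearMap.isOpen_injective (𝕜 := ℝ) (E := Z) (F := F')).preimage h1 using 1
  ext A
  simp only [Set.mem_ofPred_eq, Set.mem_preimage]
  rw [injective_iff_map_eq_zero]
  exact ⟨fun h X hX => Subtype.ext (h X.1 X.2 hX),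
    fun h X hX h0 => congrArg Subtype.val (h ⟨X, hX⟩ h0)⟩

theorem isOpen_setOf_hasSSPWrt (H : SimpleGraph V) :
    IsOpen {A : Matrix V V ℝ | HasSSPWrt A H} :=
  isOpen_setOf_forall_mem_eq_zero
    (ContinuousLinearMap.mul ℝ (Matrix V V ℝ) - (ContinuousLinearMap.mul ℝ (Matrix V V ℝ)).flip)
    (closedGraphMatricesZeroDiagSubmodule Hᶜ)

theorem isOpen_setOf_hasSAPWrt (H : SimpleGraph V) :
    IsOpen {A : Matrix V V ℝ | HasSAPWrt A H} :=
  isOpen_setOf_forall_mem_eq_zero (ContinuousLinearMap.mul ℝ (Matrix V V ℝ))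
    (closedGraphMatricesZeroDiagSubmodule Hᶜ)

theorem HasSSPWrt.hasSSP {H : SimpleGraph V} {A : Matrix V V ℝ} (h : HasSSPWrt A H)
    (hA : A ∈ graphMatrices H) : HasSSP A :=
  fun X hX hAX hdiag => h X (mem_closedGraphMatricesZeroDiag_compl hA hX hAX hdiag)

theorem HasSAPWrt.hasSAP {H : SimpleGraph V} {A : Matrix V V ℝ} (h : HasSAPWrt A H)
    (hA : A ∈ graphMatrices H) : HasSAP A :=
  fun X hX hAX hdiag => h X (mem_closedGraphMatricesZeroDiag_compl hA hX hAX hdiag)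

/-! ### Orthogonal and congruence orbits -/

/-- `K ↦ A (K - Kᵀ) - (K - Kᵀ) A`, the tangent map of the orthogonal orbit of `A`. -/
noncomputable def orbitTangent (A : Matrix V V ℝ) : Matrix V V ℝ →L[ℝ] Matrix V V ℝ :=
  ((LinearMap.mulLeft ℝ A - LinearMap.mulRight ℝ A) ∘ₗ
    (skewPart (V := V)).toLinearMap).toContinuousLinearMap

/-- `K ↦ Kᵀ A + A K`, the tangent map of the congruence orbit of `A`. -/
noncomputable def congruenceTangent (A : Matrix V V ℝ) : Matrix V V ℝ →L[ℝ] Matrix V V ℝ :=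
  (LinearMap.mulRight ℝ A ∘ₗ (transposeCLM V).toLinearMap +
    LinearMap.mulLeft ℝ A).toContinuousLinearMap

theorem hasStrictFDerivAt_exp_conj (A : Matrix V V ℝ) :
    HasStrictFDerivAt
      (fun K : Matrix V V ℝ => NormedSpace.exp (-skewPart K) * A * NormedSpace.exp (skewPart K))
      (orbitTangent A) 0 := by
  have hexp : ∀ T : Matrix V V ℝ →L[ℝ] Matrix V V ℝ,
      HasStrictFDerivAt (fun K : Matrix V V ℝ => NormedSpace.exp (T K)) T 0 := by
    intro T
    have h : HasStrictFDerivAt (NormedSpace.exp : Matrix V V ℝ → Matrix V V ℝ)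
        (1 : Matrix V V ℝ →L[ℝ] Matrix V V ℝ) (T 0) := by
      rw [map_zero]; exact hasStrictFDerivAt_exp_zero
    exact h.comp 0 T.hasStrictFDerivAt
  refine (((hexp (-skewPart)).mul_const' A).mul' (hexp skewPart)).congr_fderiv ?_
  ext1 K
  change (NormedSpace.exp (-skewPart 0) * A) * skewPart K +
    (-skewPart K * A) * NormedSpace.exp (skewPart 0) =
    A * skewPart K - skewPart K * A
  rw [map_zero, neg_zero, NormedSpace.exp_zero, one_mul, mul_one, neg_mul,
    sub_eq_add_neg]

theorem hasStrictFDerivAt_congruence (A : Matrix V V ℝ) :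
    HasStrictFDerivAt (fun K : Matrix V V ℝ => (1 + K)ᵀ * A * (1 + K)) (congruenceTangent A) 0 := by
  have h1 : HasStrictFDerivAt (fun K : Matrix V V ℝ => 1 + K) (ContinuousLinearMap.id ℝ _) 0 :=
    (hasStrictFDerivAt_id _).const_add 1
  have h2 : HasStrictFDerivAt (fun K : Matrix V V ℝ => (1 + K)ᵀ) (transposeCLM V) 0 :=
    (transposeCLM V).hasStrictFDerivAt.comp 0 h1
  refine ((h2.mul_const' A).mul' h1).congr_fderiv ?_
  ext1 K
  change ((1 + 0)ᵀ * A) * K + (Kᵀ * A) * (1 + 0) = Kᵀ * A + A * K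
  rw [add_zero, Matrix.transpose_one, one_mul, mul_one, add_comm]

theorem spec_exp_conj (A S : Matrix V V ℝ) :
    spec (NormedSpace.exp (-S) * A * NormedSpace.exp S) = spec A := by
  rw [spec, spec, Matrix.charpoly_mul_comm, ← mul_assoc,
    ← Matrix.exp_add_of_commute _ _ (Commute.refl S).neg_right]
  simp

theorem IsSSPLiberationSetOfMatrix.exists_hasSSP {G : SimpleGraph V} {A : Matrix V V ℝ}
    {β : Finset (Sym2 V)} (hA : A ∈ graphMatrices G) (h : IsSSPLiberationSetOfMatrix G A β) :
    ∃ A' ∈ graphMatrices (addEdges G β), HasSSP A' ∧ spec A' = spec A := by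
  obtain ⟨hne, hβ, hlib⟩ := h
  have hlib' : ∀ e ∈ β, HasSSPWrt A (addEdges G (β.erase e)) := fun e he =>
    hlib _ (Finset.erase_ssubset he) (Finset.card_erase_of_mem he)
  have hd := hasStrictFDerivAt_exp_conj A
  set Φ := fun K : Matrix V V ℝ => NormedSpace.exp (-skewPart K) * A * NormedSpace.exp (skewPart K)
    with hΦ
  have hΦ0 : Φ 0 = A := by simp [hΦ]
  have hfreq := frequently_mem_graphMatrices_addEdges hne hβ hd
    (fun K => by
      have h1 : (skewPart K)ᵀ = -skewPart K := by simp [skewPart_apply]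
      simp only [hΦ, Matrix.IsSymm, Matrix.transpose_mul, ← Matrix.exp_transpose, hA.1.eq, h1,
        Matrix.transpose_neg, neg_neg, mul_assoc])
    (by rwa [hΦ0])
    (fun e he X hX hXL => by
      refine hlib' e he X hX ?_
      -- Test with `K = Cᵀ`, where `C = XA - AX` is skew: orthogonality to the orbit becomes `2 tr(C
      -- Cᵀ) = 0`.
      have hC : X * A - A * X = 0 := by
        apply eq_zero_of_trace_mul_transpose_self
        have h1 : (X * (A * skewPart (X * A - A * X)ᵀ - skewPart (X * A - A * X)ᵀ * A)).trace = 0 :=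
          hXL (X * A - A * X)ᵀ
        have h2 : skewPart (X * A - A * X)ᵀ = (2 : ℝ) • (X * A - A * X)ᵀ := by
          simp only [skewPart_apply, Matrix.transpose_sub, Matrix.transpose_mul, hX.1.eq, hA.1.eq,
            two_smul]
          abel
        rw [h2] at h1
        simp only [mul_smul_comm, smul_mul_assoc, ← smul_sub, Matrix.trace_smul, smul_eq_mul,
          mul_eq_zero, OfNat.ofNat_ne_zero, false_or] at h1
        rw [sub_mul, Matrix.trace_sub]
        rw [mul_sub, Matrix.trace_sub] at h1
        rw [mul_assoc, mul_assoc, Matrix.trace_mul_comm A, mul_assoc]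
        exact h1
      rw [← neg_sub, hC, neg_zero])
  have hopen : ∀ᶠ K in 𝓝 0, HasSSPWrt (Φ K) (addEdges G β) := by
    refine hd.hasFDerivAt.continuousAt.eventually
      ((isOpen_setOf_hasSSPWrt (addEdges G β)).eventually_mem ?_)
    rw [Set.mem_ofPred_eq]
    obtain ⟨e, he⟩ := hne
    intro X hX hAX
    rw [hΦ0] at hAX
    exact hlib' e he X (closedGraphMatricesZeroDiag_mono
      (compl_le_compl (addEdges_mono G (Finset.erase_subset e β))) hX) hAX
  obtain ⟨K, hK1, hK2⟩ := (hfreq.and_eventually hopen).exists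
  exact ⟨Φ K, hK1, hK2.hasSSP hK1, spec_exp_conj A _⟩

theorem IsSAPLiberationSetOfMatrix.exists_hasSAP {G : SimpleGraph V} {A : Matrix V V ℝ}
    {β : Finset (Sym2 V)} (hA : A ∈ graphMatrices G) (h : IsSAPLiberationSetOfMatrix G A β) :
    ∃ A' ∈ graphMatrices (addEdges G β), HasSAP A' ∧ A'.rank = A.rank := by
  obtain ⟨hne, hβ, hlib⟩ := h
  have hlib' : ∀ e ∈ β, HasSAPWrt A (addEdges G (β.erase e)) := fun e he =>
    hlib _ (Finset.erase_ssubset he) (Finset.card_erase_of_mem he)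
  have hd := hasStrictFDerivAt_congruence A
  set Φ := fun K : Matrix V V ℝ => (1 + K)ᵀ * A * (1 + K) with hΦ
  have hΦ0 : Φ 0 = A := by simp [hΦ]
  have hfreq := frequently_mem_graphMatrices_addEdges hne hβ hd
    (fun K => by
      simp only [hΦ, Matrix.IsSymm, Matrix.transpose_mul, Matrix.transpose_transpose, hA.1.eq,
        mul_assoc])
    (by rwa [hΦ0])
    (fun e he X hX hXL => by
      refine hlib' e he X hX ?_
      have hT : (X * A)ᵀ = A * X := by rw [Matrix.transpose_mul, hX.1.eq, hA.1.eq]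
      -- Testing with `K = AX` gives `2 tr(C Cᵀ) = 0` for `C = XA`.
      have hC : X * A = 0 := by
        apply eq_zero_of_trace_mul_transpose_self
        have h1 : (X * ((A * X)ᵀ * A + A * (A * X))).trace = 0 := hXL (A * X)
        have h2 : (X * (X * A * A)).trace = (X * A * (A * X)).trace := by
          rw [Matrix.trace_mul_comm, mul_assoc]
        rw [← hT, Matrix.transpose_transpose, hT, mul_add, Matrix.trace_add, h2,
          ← mul_assoc X A] at h1
        rw [hT]
        linarith
      rw [← hT, hC, Matrix.transpose_zero])
  have hopen : ∀ᶠ K in 𝓝 0, HasSAPWrt (Φ K) (addEdges G β) := by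
    refine hd.hasFDerivAt.continuousAt.eventually
      ((isOpen_setOf_hasSAPWrt (addEdges G β)).eventually_mem ?_)
    rw [Set.mem_ofPred_eq]
    obtain ⟨e, he⟩ := hne
    intro X hX hAX
    rw [hΦ0] at hAX
    exact hlib' e he X (closedGraphMatricesZeroDiag_mono
      (compl_le_compl (addEdges_mono G (Finset.erase_subset e β))) hX) hAX
  have hunit : ∀ᶠ K : Matrix V V ℝ in 𝓝 0, (1 + K).det ≠ 0 := by
    have hc : Continuous fun K : Matrix V V ℝ => (1 + K).det :=
      (continuous_const.add continuous_id).matrix_det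
    exact hc.continuousAt.eventually_ne (by simp)
  obtain ⟨K, hK1, hK2, hK3⟩ := (hfreq.and_eventually (hopen.and hunit)).exists
  refine ⟨Φ K, hK1, hK2.hasSAP hK1, ?_⟩
  rw [Matrix.rank_mul_eq_left_of_isUnit_det _ _ hK3.isUnit,
    Matrix.rank_mul_eq_right_of_isUnit_det _ _ (by rw [Matrix.det_transpose]; exact hK3.isUnit)]

end InverseEigenvalue

theorem theorem4p2 {V : Type*} [Fintype V] [DecidableEq V] (G : SimpleGraph V)
    (β : Finset (Sym2 V)) :
    (InverseEigenvalue.IsSSPLiberationSet G β →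
      ∀ Λ : Multiset ℝ,
        (∃ A ∈ InverseEigenvalue.graphMatrices G, InverseEigenvalue.spec A = Λ) →
        ∃ A' ∈ InverseEigenvalue.graphMatrices (InverseEigenvalue.addEdges G β),
          InverseEigenvalue.HasSSP A' ∧ InverseEigenvalue.spec A' = Λ) ∧
    (InverseEigenvalue.IsSAPLiberationSet G β →
      ∀ r : ℕ,
        (∃ A ∈ InverseEigenvalue.graphMatrices G, A.rank = r) →
        ∃ A' ∈ InverseEigenvalue.graphMatrices (InverseEigenvalue.addEdges G β),
          InverseEigenvalue.HasSAP A' ∧ A'.rank = r) := by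
  constructor
  · rintro h _ ⟨A, hA, rfl⟩
    exact (h A hA).exists_hasSSP hA
  · rintro h _ ⟨A, hA, rfl⟩
    exact (h A hA).exists_hasSAP hA
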